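/- Let $\Sigma$ be a finite set of real $n\times n$ matrices. $\Sigma$ is called CP if the following three conditions hold. (LCP) For every sequence $A_1,A_2,\dots$ in $\Sigma$ the products $A_m\cdots A_1$ converge as $m\to\infty$. (RCP) For every such sequence the products $A_1\cdots A_m$ converge. (Transversality) $\mathbb R^n=N_{\Sigma'}\oplus R_{\Sigma'}$ for every $\Sigma'\subseteq\Sigma$, where $N_{\Sigma'}=\bigcap_{a\in\Sigma'}\ker(I-a)$ and $R_{\Sigma'}=\sum_{a\in\Sigma'}\operatorname{ran}(I-a)$ (so $N_\emptyset=\mathbb R^n$, $R_\emptyset=0$). Let $R$ be a linearly ordered set and $A:R\to\Sigma$ a map. For $S\subseteq R$, an interval of $S$ is a set $T\subseteq S$ such that $a,b\in T$, $g\in S$, $a<g<b$ imply $g\in T$; it is complete if $A(T)=A(S)$ and incomplete otherwise. Let $I_S(A)\in\{0,1,2,\dots\}\cup\{\infty\}$ be the maximal number of pairwise disjoint complete intervals of $S$. The ordered product $M(S)$ is defined recursively (on the number of elements of $A(S)$) as follows. - If $S=\{s_1<\dots<s_k\}$ is finite, then $M(S)=A(s_1)\cdots A(s_k)$, with $M(\emptyset)=I$.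 - If $I_S(A)=\infty$, then $M(S)$ is the projection onto $N_{A(S)}$ along $R_{A(S)}$. - If $I_S(A)<\infty$ and $S$ is infinite, then $M(S)=M(T_1)\cdots M(T_k)$, where $S=T_1\cup\dots\cup T_k$ is a partition of $S$ into finitely many adjacent incomplete intervals $T_1<\dots<T_k$. **Theorem 5.3.** Let $\Sigma$ be a finite CP set of real $n\times n$ matrices, and fix a norm $\|\cdot\|$ on the $n\times n$ matrices. There is a constant $V<\infty$, depending only on $\Sigma$ (and the norm), such that the following holds. Let $R$ be a linearly ordered set and let $A:R\to\Sigma$ be any map. Then, for every $S\subseteq R$, the construction above yields exactly one matrix $M(S)$. Moreover, let $Q$ be a linearly ordered set and let $B:Q\to2^R$ be monotone, that is, $B(q_1)\subseteq B(q_2)$ whenever $q_1\le q_2$. Then the map $M'(q)=M(B(q))$ has variation at most $V$, that is, $$\sum_{i=1}^{m-1}\|M'(q_{i+1})-M'(q_i)\|\le V\qquad\text{for all } m\ge1 \text{ and all } q_1\le q_2\le\dots\le q_m \text{ in } Q .$$ In particular, $M'$ has bounded variation. -/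

import Mathlib

open Filter Topology
open scoped NNReal ENNReal Matrix

universe u v

/- Square real matrices are normed by the operator norm induced by the sup norm of `ℝⁿ`
(all norms on this space are equivalent). -/
attribute [local instance] Matrix.linftyOpNormedAddCommGroup

namespace ContProd

/-- Left convergent products: for every sequence `s` in `Sg`, the products
`s (m-1) * ⋯ * s 1 * s 0` converge as `m → ∞`. -/
def IsLCP {n : ℕ} (Sg : Set (Matrix (Fin n) (Fin n) ℝ)) : Prop :=
  ∀ s : ℕ → Matrix (Fin n) (Fin n) ℝ, (∀ i, s i ∈ Sg) →
    ∃ L : Matrix (Fin n) (Fin n) ℝ,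
      Tendsto (fun m : ℕ => ((List.range m).map s).reverse.prod) atTop (𝓝 L)

/-- Right convergent products: for every sequence `s` in `Sg`, the products
`s 0 * s 1 * ⋯ * s (m-1)` converge as `m → ∞`. -/
def IsRCP {n : ℕ} (Sg : Set (Matrix (Fin n) (Fin n) ℝ)) : Prop :=
  ∀ s : ℕ → Matrix (Fin n) (Fin n) ℝ, (∀ i, s i ∈ Sg) →
    ∃ L : Matrix (Fin n) (Fin n) ℝ,
      Tendsto (fun m : ℕ => ((List.range m).map s).prod) atTop (𝓝 L)

/-- The intersection of the null spaces of `I - a`, `a ∈ T` (all of `ℝⁿ` if `T` is empty). -/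
def nullSpace {n : ℕ} (T : Set (Matrix (Fin n) (Fin n) ℝ)) : Submodule ℝ (Fin n → ℝ) :=
  ⨅ a ∈ T, LinearMap.ker (Matrix.toLin' (1 - a))

/-- The span of the ranges of `I - a`, `a ∈ T` (zero if `T` is empty). -/
def rangeSpace {n : ℕ} (T : Set (Matrix (Fin n) (Fin n) ℝ)) : Submodule ℝ (Fin n → ℝ) :=
  ⨆ a ∈ T, LinearMap.range (Matrix.toLin' (1 - a))

/-- Transversality: `ℝⁿ` is the direct sum of the null space and the range space of every
subfamily. -/
def IsTransversal {n : ℕ} (Sg : Set (Matrix (Fin n) (Fin n) ℝ)) : Prop :=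
  ∀ T : Set (Matrix (Fin n) (Fin n) ℝ), T ⊆ Sg → IsCompl (nullSpace T) (rangeSpace T)

/-- CP sets of matrices. -/
structure IsCP {n : ℕ} (Sg : Set (Matrix (Fin n) (Fin n) ℝ)) : Prop where
  lcp : IsLCP Sg
  rcp : IsRCP Sg
  transversal : IsTransversal Sg

/-- `P` is the matrix of the projection onto `nullSpace T` along `rangeSpace T`. -/
def IsProjection {n : ℕ} (T : Set (Matrix (Fin n) (Fin n) ℝ))
    (P : Matrix (Fin n) (Fin n) ℝ) : Prop :=
  ∀ x : Fin n → ℝ, P *ᵥ x ∈ nullSpace T ∧ x - P *ᵥ x ∈ rangeSpace T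

/-- `T` is an interval (a subset without holes) of the linearly ordered set `S`, on which `A`
takes all the values that it takes on `S`. -/
structure IsCompleteInterval {n : ℕ} {R : Type*} [LinearOrder R]
    (A : R → Matrix (Fin n) (Fin n) ℝ) (S T : Set R) : Prop where
  subset : T ⊆ S
  no_holes : ∀ a ∈ T, ∀ b ∈ T, ∀ g ∈ S, a < g → g < b → g ∈ T
  image_eq : A '' T = A '' S

/-- The maximal number (possibly `∞`) of pairwise disjoint complete intervals of `S`. -/
noncomputable def completeCount {n : ℕ} {R : Type*} [LinearOrder R]
    (A : R → Matrix (Fin n) (Fin n) ℝ) (S : Set R) : ℕ∞ :=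
  ⨆ (F : Finset (Set R)) (_ : ∀ T ∈ F, IsCompleteInterval A S T)
    (_ : (F : Set (Set R)).PairwiseDisjoint id), (F.card : ℕ∞)

/-- `IsProduct A S P`: the recursive construction of the ordered product of `A` over `S`
(recursively in the number of values of `A` on `S`) yields the matrix `P`. -/
inductive IsProduct {n : ℕ} {R : Type*} [LinearOrder R] (A : R → Matrix (Fin n) (Fin n) ℝ) :
    Set R → Matrix (Fin n) (Fin n) ℝ → Prop
  /-- Over a finite set `s₁ < ⋯ < sₖ` the product is `A s₁ * ⋯ * A sₖ`. -/
  | finite (S : Set R) (hS : S.Finite) :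
      IsProduct A S ((hS.toFinset.sort (· ≤ ·)).map A).prod
  /-- If there are arbitrarily many disjoint complete intervals, the product is the projection
  that belongs to the set of values of `A` on `S`. -/
  | projection (S : Set R) (P : Matrix (Fin n) (Fin n) ℝ)
      (hI : completeCount A S = ⊤) (hP : IsProjection (A '' S) P) :
      IsProduct A S P
  /-- Otherwise, `S` is cut into finitely many adjacent incomplete intervals
  `T 0 < ⋯ < T (k-1)`, and the products over these are multiplied in their order. -/
  | concat (S : Set R) (k : ℕ) (T : Fin k → Set R) (P : Fin k → Matrix (Fin n) (Fin n) ℝ)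
      (hI : completeCount A S ≠ ⊤)
      (hunion : ⋃ i, T i = S)
      (hlt : ∀ i j, i < j → ∀ a ∈ T i, ∀ b ∈ T j, a < b)
      (hinc : ∀ i, A '' T i ≠ A '' S)
      (hprod : ∀ i, IsProduct A (T i) (P i)) :
      IsProduct A S (List.ofFn P).prod

/-- The ordered product `M(S)` of `A` over `S`: the matrix given by the recursive construction
(for values in a finite CP set it gives exactly one matrix). -/
noncomputable def M {n : ℕ} {R : Type*} [LinearOrder R]
    (A : R → Matrix (Fin n) (Fin n) ℝ) (S : Set R) : Matrix (Fin n) (Fin n) ℝ :=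
  Classical.epsilon (IsProduct A S)

end ContProd

namespace ContProd

/-! ### Infinite concatenations of words -/

/-! The ordered product over `S` is the limit of the finite ordered products over `F ∩ S`, as `F`
runs through the directed set of finite subsets of `R` (`IsProduct.tendsto`). Uniqueness of the
product is then uniqueness of limits, and a variation bound for finite products that is uniform in
`F` passes to the limit.

Two facts about words carry this. Products of all words are bounded
(`RightConvergent.exists_bound`), and a word with sufficiently many complete blocks has a product
close to the projection `P` of its alphabet (`RightConvergent.exists_blocks`).

For the variation, give each letter of a finite word the time at which it appears and induct on the
alphabet (`exists_timedVar_le`). While few complete blocks are present, the word splits into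
boundedly many pieces over smaller alphabets. Once there are many, cut it into two halves with
products near `P`; an increment of either half is annihilated by `P`, so the other half multiplies
it by a small factor. Hence the supremum of all variations is at most a constant plus half of
itself.

Existence of the product is combinatorial: a set that cannot be cut into finitely many incomplete
parts contains arbitrarily many disjoint complete intervals (`exists_intervals_of_not_isCuttable`).
-/

theorem exists_seq_of_words {α : Type*} (f : ℕ → List α) (hf : ∀ k, f k ≠ []) :
    ∃ (s : ℕ → α) (n : ℕ → ℕ), StrictMono n ∧
      (∀ k, (List.range (n k)).map s = (List.range k).flatMap f) ∧
      ∀ k, ∀ a ∈ f k, ∃ i, k ≤ i ∧ s i = a := by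
  set g : ℕ → List α := fun k => (List.range k).flatMap f with hg
  have hsucc : ∀ k, g (k + 1) = g k ++ f k := fun k => by
    simp [hg, List.range_succ, List.flatMap_append]
  have hmono : StrictMono fun k => (g k).length := strictMono_nat_of_lt_succ fun k => by
    have := List.length_pos_iff.2 (hf k)
    simp only [hsucc, List.length_append]; omega
  have hlen : ∀ k, k ≤ (g k).length := fun k => hmono.le_apply
  have hpre : ∀ a b, a ≤ b → g a <+: g b := fun a b hab => by
    induction b, hab using Nat.le_induction with
    | base => exact List.prefix_rfl
    | succ b _ ih => exact ih.trans (hsucc b ▸ List.prefix_append _ _)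
  let s : ℕ → α := fun i => (g (i + 1))[i]'(hlen (i + 1))
  have hs : ∀ k i (h : i < (g k).length), s i = (g k)[i] := fun k i h => by
    rcases le_total (i + 1) k with hk | hk
    · exact (hpre _ _ hk).getElem _
    · exact ((hpre _ _ hk).getElem h).symm
  refine ⟨s, fun k => (g k).length, hmono, fun k => ?_, fun k a ha => ?_⟩
  · refine List.ext_getElem (by simp [hg]) fun i h₁ h₂ => ?_
    simpa using hs k i h₂
  · obtain ⟨j, hj, rfl⟩ := List.getElem_of_mem ha
    refine ⟨(g k).length + j, (hlen k).trans (Nat.le_add_right _ _), ?_⟩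
    rw [hs (k + 1) _ (by rw [hsucc, List.length_append]; omega)]
    simp [hsucc]

/-- This turns "every good word extends to a better one" into an infinite sequence to which
convergence of products can be applied. The last clause makes letters that occur in every added word
recur infinitely often. -/
theorem exists_seq_of_step {α : Type*} (Q : ℕ → List α → Prop) (r : List α → Prop)
    (h0 : Q 0 []) (step : ∀ k w, Q k w → ∃ u, u ≠ [] ∧ r u ∧ Q (k + 1) (w ++ u)) :
    ∃ (s : ℕ → α) (n : ℕ → ℕ), StrictMono n ∧ (∀ k, Q k ((List.range (n k)).map s)) ∧
      ∀ k, ∃ u, r u ∧ ∀ a ∈ u, ∃ i, k ≤ i ∧ s i = a := by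
  choose u hu using step
  let p : ∀ k, {w // Q k w} := fun k =>
    Nat.rec ⟨[], h0⟩ (fun k w => ⟨w.1 ++ u k w.1 w.2, (hu k w.1 w.2).2.2⟩) k
  let f : ℕ → List α := fun k => u k (p k).1 (p k).2
  have hp : ∀ k, (List.range k).flatMap f = (p k).1 := fun k => by
    induction k with
    | zero => rfl
    | succ k ih => rw [List.range_succ, List.flatMap_append, ih]; simp [p, f]
  obtain ⟨s, n, hn, h₁, h₂⟩ := exists_seq_of_words f fun k => (hu k _ (p k).2).1
  refine ⟨s, n, hn, fun k => ?_, fun k => ⟨f k, (hu k _ (p k).2).2.1, h₂ k⟩⟩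
  rw [h₁, hp]
  exact (p k).2

/-! ### Complete blocks -/

/-- The word `w` contains `m` consecutive blocks in which all letters of `C` occur. -/
def HasBlocks {α : Type*} (C : Set α) : ℕ → List α → Prop
  | 0, _ => True
  | m + 1, w => ∃ u v, w = u ++ v ∧ (∀ c ∈ C, c ∈ u) ∧ HasBlocks C m v

theorem HasBlocks.sublist {α : Type*} {C : Set α} {m : ℕ} {w w' : List α}
    (h : HasBlocks C m w) (hw : w.Sublist w') : HasBlocks C m w' := by
  induction m generalizing w w' with
  | zero => trivial
  | succ m ih =>
    obtain ⟨u, v, rfl, hu, hv⟩ := h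
    obtain ⟨u', v', rfl, hu', hv'⟩ := List.append_sublist_iff.1 hw
    exact ⟨u', v', rfl, fun c hc => hu'.subset (hu c hc), ih hv hv'⟩

theorem HasBlocks.mono {α : Type*} {C : Set α} {m k : ℕ} {w : List α}
    (h : HasBlocks C m w) (hk : k ≤ m) : HasBlocks C k w := by
  induction m generalizing w k with
  | zero => obtain rfl : k = 0 := by omega
            trivial
  | succ m ih =>
    cases k with
    | zero => trivial
    | succ k =>
      obtain ⟨u, v, rfl, hu, hv⟩ := h
      exact ⟨u, v, rfl, hu, ih hv (by omega)⟩

theorem HasBlocks.exists_append {α : Type*} {C : Set α} {m k : ℕ} {w : List α}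
    (h : HasBlocks C (m + k) w) :
    ∃ u v, w = u ++ v ∧ HasBlocks C m u ∧ HasBlocks C k v := by
  induction m generalizing w with
  | zero => exact ⟨[], w, rfl, trivial, by simpa using h⟩
  | succ m ih =>
    rw [Nat.add_right_comm] at h
    obtain ⟨u, v, rfl, hu, hv⟩ := h
    obtain ⟨x, y, rfl, hx, hy⟩ := ih hv
    exact ⟨u ++ x, y, by simp, ⟨u, x, rfl, hu, hx⟩, hy⟩

theorem exists_first_prefix {α : Type*} (p : List α → Prop) (h0 : ¬ p []) (l : List α)
    (hl : p l) : ∃ u a v, l = u ++ a :: v ∧ ¬ p u ∧ p (u ++ [a]) := by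
  induction l using List.reverseRecOn with
  | nil => exact absurd hl h0
  | append_singleton l a ih =>
    by_cases h : p l
    · obtain ⟨u, b, v, rfl, hu, hb⟩ := ih h
      exact ⟨u, b, v ++ [a], by simp, hu, hb⟩
    · exact ⟨l, a, [], rfl, h, hl⟩

/-! ### Boundedness of products -/

section Algebra

variable {𝔸 : Type*} [NormedRing 𝔸]

/-- All products `s 0 * ⋯ * s (m-1)` of elements of `C` converge. -/
def RightConvergent (C : Set 𝔸) : Prop :=
  ∀ s : ℕ → 𝔸, (∀ i, s i ∈ C) →
    ∃ L : 𝔸, Tendsto (fun m : ℕ => ((List.range m).map s).prod) atTop (𝓝 L)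

theorem RightConvergent.mono {C D : Set 𝔸} (h : RightConvergent D) (hCD : C ⊆ D) :
    RightConvergent C := fun s hs => h s fun i => hCD (hs i)

/-- The elements with bounded orbit under right multiplication form a subspace `W`. If `1` were
outside `W`, one could multiply on forever, staying outside `W` with norms growing beyond every
bound, against convergence. -/
theorem RightConvergent.exists_bound [NormedAlgebra ℝ 𝔸] [FiniteDimensional ℝ 𝔸] {C : Set 𝔸}
    (hC : RightConvergent C) (hfin : C.Finite) :
    ∃ K : ℝ, 1 ≤ K ∧ ∀ w : List 𝔸, (∀ a ∈ w, a ∈ C) → ‖w.prod‖ ≤ K := by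
  let W : Submodule ℝ 𝔸 :=
    { carrier := {x | ∃ K : ℝ, ∀ w : List 𝔸, (∀ a ∈ w, a ∈ C) → ‖x * w.prod‖ ≤ K}
      add_mem' := by
        rintro x y ⟨K, hK⟩ ⟨L, hL⟩
        refine ⟨K + L, fun w hw => ?_⟩
        rw [add_mul]
        exact (norm_add_le _ _).trans (add_le_add (hK w hw) (hL w hw))
      zero_mem' := ⟨0, fun w _ => by simp⟩
      smul_mem' := by
        rintro c x ⟨K, hK⟩
        refine ⟨‖c‖ * K, fun w hw => ?_⟩
        rw [smul_mul_assoc, norm_smul]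
        exact mul_le_mul_of_nonneg_left (hK w hw) (norm_nonneg _) }
  obtain ⟨K₀, hK₀⟩ : ∃ K₀ : ℝ, ∀ x ∈ W, ∀ w : List 𝔸, (∀ a ∈ w, a ∈ C) →
      ‖x * w.prod‖ ≤ K₀ * ‖x‖ := by
    obtain ⟨K₀, h⟩ := banach_steinhaus
      (g := fun w : {w : List 𝔸 // ∀ a ∈ w, a ∈ C} =>
        ((ContinuousLinearMap.mul ℝ 𝔸).flip w.1.prod).comp W.subtypeL)
      (fun x => by
        obtain ⟨K, hK⟩ := x.2
        exact ⟨K, fun w => hK w.1 w.2⟩)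
    exact ⟨K₀, fun x hx w hw => ContinuousLinearMap.le_of_opNorm_le _ (h ⟨w, hw⟩) ⟨x, hx⟩⟩
  obtain ⟨D, hD⟩ : ∃ D : ℝ, ∀ a ∈ C, ‖a‖ ≤ D := by
    obtain ⟨D, hD⟩ := (hfin.image norm).bddAbove
    exact ⟨D, fun a ha => hD ⟨a, ha, rfl⟩⟩
  -- Otherwise the orbit of `x` has norm at most `K` as long as it avoids `W`. It enters `W` with
  -- norm at most `K * D`, and from there the uniform bound on `W` applies, so `x` itself would lie
  -- in `W`.
  have key : ∀ x, x ∉ W → ∀ K : ℝ, ∃ w : List 𝔸, (∀ a ∈ w, a ∈ C) ∧ x * w.prod ∉ W ∧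
      K < ‖x * w.prod‖ := by
    intro x hx K
    by_contra! hcon
    have h1 : ∀ w : List 𝔸, (∀ a ∈ w, a ∈ C) → x * w.prod ∈ W → ∀ v : List 𝔸,
        (∀ a ∈ v, a ∈ C) → ‖x * w.prod * v.prod‖ ≤ |K₀| * (K * D) := by
      intro w
      induction w using List.reverseRecOn with
      | nil => intro _ h; exact absurd (by simpa using h) hx
      | append_singleton w a ih =>
        intro hw hmem v hv
        have hw' : ∀ b ∈ w, b ∈ C := fun b hb => hw b (by simp [hb])
        have ha : a ∈ C := hw a (by simp)
        by_cases hm : x * w.prod ∈ W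
        · have := ih hw' hm (a :: v) (by simpa [ha] using hv)
          simpa [mul_assoc] using this
        · refine (hK₀ _ hmem v hv).trans ?_
          refine (mul_le_mul_of_nonneg_right (le_abs_self K₀) (norm_nonneg _)).trans ?_
          refine mul_le_mul_of_nonneg_left ?_ (abs_nonneg _)
          rw [List.prod_append, List.prod_singleton, ← mul_assoc]
          have h2 := hcon w hw' hm
          exact (norm_mul_le _ _).trans
            (mul_le_mul h2 (hD a ha) (norm_nonneg _) ((norm_nonneg _).trans h2))
    refine hx ⟨max K (|K₀| * (K * D)), fun w hw => ?_⟩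
    by_cases hm : x * w.prod ∈ W
    · exact le_max_of_le_right (by simpa using h1 w hw hm [] (by simp))
    · exact le_max_of_le_left (hcon w hw hm)
  have hone : (1 : 𝔸) ∈ W := by
    by_contra hone
    obtain ⟨s, n, hn, hQ, -⟩ := exists_seq_of_step
      (fun k w => (∀ a ∈ w, a ∈ C) ∧ w.prod ∉ W ∧ (k : ℝ) - 1 < max ‖w.prod‖ 0) (fun _ => True)
      ⟨by simp, by simpa using hone, lt_max_of_lt_right (by norm_num)⟩ (by
        rintro k w ⟨h1, h2, -⟩
        -- Exceeding `‖w.prod‖` as well forces `u` to be nonempty.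
        obtain ⟨u, hu1, hu2, hu3⟩ := key _ h2 (max k ‖w.prod‖)
        refine ⟨u, ?_, trivial, ?_, by simpa using hu2, ?_⟩
        · rintro rfl
          simp at hu3
        · intro a ha
          rcases List.mem_append.1 ha with ha | ha
          exacts [h1 a ha, hu1 a ha]
        · rw [List.prod_append]
          push_cast
          exact lt_max_of_lt_left (by linarith [le_max_left (k : ℝ) ‖w.prod‖]))
    have hs : ∀ i, s i ∈ C := fun i =>
      (hQ (i + 1)).1 _ (List.mem_map.2 ⟨i, List.mem_range.2 hn.le_apply, rfl⟩)
    obtain ⟨L, hL⟩ := hC s hs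
    obtain ⟨B, hB⟩ := (Metric.isBounded_range_of_tendsto _ hL).exists_norm_le
    obtain ⟨k, hk⟩ := exists_nat_gt (max B 0 + 1)
    have h3 := (hQ k).2.2
    have h4 := max_le_max_right 0 (hB _ ⟨n k, rfl⟩)
    simp only at h4
    linarith
  obtain ⟨K, hK⟩ := hone
  exact ⟨max 1 K, le_max_left _ _, fun w hw => le_max_of_le_right (by simpa using hK w hw)⟩

/-! ### Convergence to the projection -/

/-- `P` is the limit of products in which all elements of `C` occur often. -/
structure IsLimitProjection (C : Set 𝔸) (P : 𝔸) : Prop where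
  mul_left : ∀ a ∈ C, a * P = P
  mul_right : ∀ a ∈ C, P * a = P
  eq_of_fixed : ∀ L : 𝔸, (∀ a ∈ C, L * a = L) → L * P = L

theorem IsLimitProjection.prod_mul {C : Set 𝔸} {P : 𝔸} (hP : IsLimitProjection C P)
    (w : List 𝔸) (hw : ∀ a ∈ w, a ∈ C) : w.prod * P = P := by
  induction w with
  | nil => simp
  | cons a w ih =>
    rw [List.prod_cons, mul_assoc, ih fun b hb => hw b (by simp [hb]),
      hP.mul_left a (hw a (by simp))]

theorem IsLimitProjection.mul_prod {C : Set 𝔸} {P : 𝔸} (hP : IsLimitProjection C P)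
    (w : List 𝔸) (hw : ∀ a ∈ w, a ∈ C) : P * w.prod = P := by
  induction w with
  | nil => simp
  | cons a w ih =>
    rw [List.prod_cons, ← mul_assoc, hP.mul_right a (hw a (by simp)),
      ih fun b hb => hw b (by simp [hb])]

/-- A compactness argument: from bad words with ever more blocks, one infinite sequence is assembled
whose prefixes all remain bad and in which every letter recurs. Its limit `L` is fixed by every
letter, so `L * P = L`, which contradicts badness. -/
theorem RightConvergent.exists_blocks [NormedAlgebra ℝ 𝔸] [FiniteDimensional ℝ 𝔸] {C : Set 𝔸}
    (hC : RightConvergent C) {K : ℝ} (hK : ∀ w : List 𝔸, (∀ a ∈ w, a ∈ C) → ‖w.prod‖ ≤ K)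
    {P : 𝔸} (hP : IsLimitProjection C P) {ε : ℝ} (hε : 0 < ε) :
    ∃ m, ∀ w : List 𝔸, (∀ a ∈ w, a ∈ C) → HasBlocks C m w → ‖w.prod - P‖ ≤ ε := by
  have : ProperSpace 𝔸 := FiniteDimensional.proper_real 𝔸
  rcases C.eq_empty_or_nonempty with rfl | ⟨c, hc⟩
  · refine ⟨0, fun w hw _ => ?_⟩
    obtain rfl := List.eq_nil_iff_forall_not_mem.2 hw
    have := hP.eq_of_fixed 1 (by simp)
    rw [one_mul] at this
    simpa [this] using hε.le
  by_contra! hcon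
  have hK0 : 0 ≤ K := (norm_nonneg _).trans (hK [] (by simp))
  let Bad : ℝ → 𝔸 → Prop := fun δ x =>
    ∀ m, ∃ w : List 𝔸, (∀ a ∈ w, a ∈ C) ∧ HasBlocks C m w ∧ δ < ‖x * w.prod - x * P‖
  -- The first blocks of the bad words are bounded, hence subconverge. One late block `u` can
  -- replace all later ones at a cost of at most `δ - δ'`.
  have step : ∀ x δ δ', δ' < δ → Bad δ x →
      ∃ u : List 𝔸, (∀ a ∈ u, a ∈ C) ∧ (∀ c ∈ C, c ∈ u) ∧ Bad δ' (x * u.prod) := by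
    intro x δ δ' hδ hx
    have hx' : ∀ m, ∃ u v : List 𝔸, (∀ a ∈ u, a ∈ C) ∧ (∀ a ∈ v, a ∈ C) ∧ (∀ c ∈ C, c ∈ u) ∧
        HasBlocks C m v ∧ δ < ‖x * u.prod * v.prod - x * P‖ := by
      intro m
      obtain ⟨w, hw, ⟨u, v, rfl, hu, hv⟩, h⟩ := hx (m + 1)
      exact ⟨u, v, fun a ha => hw a (by simp [ha]), fun a ha => hw a (by simp [ha]), hu, hv,
        by simpa [mul_assoc] using h⟩
    choose u v hu hv huC hvC huv using hx'
    obtain ⟨y, -, φ, hφ, hy⟩ := tendsto_subseq_of_bounded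
      (Metric.isBounded_closedBall (x := (0 : 𝔸)) (r := K)) (x := fun m => (u m).prod)
      (fun m => by simpa using hK _ (hu m))
    obtain ⟨η, hη, hη'⟩ : ∃ η : ℝ, 0 < η ∧ ‖x‖ * η * K ≤ δ - δ' := by
      refine ⟨(δ - δ') / (‖x‖ * K + 1), div_pos (by linarith) (by positivity), ?_⟩
      rw [mul_div_assoc', div_mul_eq_mul_div, div_le_iff₀ (by positivity)]
      nlinarith
    obtain ⟨M, hM⟩ := Metric.cauchySeq_iff.1 hy.cauchySeq η hη
    refine ⟨u (φ M), hu _, huC _, fun m => ?_⟩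
    have h1 := huv (φ (max m M))
    have h2 : ‖x * ((u (φ (max m M))).prod - (u (φ M)).prod) * (v (φ (max m M))).prod‖
        ≤ δ - δ' := by
      refine le_trans ?_ hη'
      refine (norm_mul_le _ _).trans (mul_le_mul ?_ (hK _ (hv _)) (norm_nonneg _) (by positivity))
      refine (norm_mul_le _ _).trans (mul_le_mul_of_nonneg_left ?_ (norm_nonneg _))
      have := hM (max m M) (le_max_right _ _) M le_rfl
      rw [dist_eq_norm] at this
      exact this.le
    refine ⟨v (φ (max m M)), hv _, (hvC _).mono ((le_max_left m M).trans hφ.le_apply), ?_⟩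
    rw [mul_assoc x _ P, hP.prod_mul _ (hu _)]
    have h3 := norm_sub_le (x * (u (φ (max m M))).prod * (v (φ (max m M))).prod - x * P)
      (x * (u (φ M)).prod * (v (φ (max m M))).prod - x * P)
    have h4 : x * ((u (φ (max m M))).prod - (u (φ M)).prod) * (v (φ (max m M))).prod =
      (x * (u (φ (max m M))).prod * (v (φ (max m M))).prod - x * P) -
      (x * (u (φ M)).prod * (v (φ (max m M))).prod - x * P) := by noncomm_ring
    rw [h4] at h2
    have h5 := norm_sub_norm_le (x * (u (φ (max m M))).prod * (v (φ (max m M))).prod - x * P)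
      (x * (u (φ M)).prod * (v (φ (max m M))).prod - x * P)
    linarith
  -- The thresholds start at `ε` and decrease strictly, but stay above `ε / 2`.
  obtain ⟨s, n, hn, hQ, hrec⟩ := exists_seq_of_step
    (fun k w => (∀ a ∈ w, a ∈ C) ∧ Bad (ε * (1 / 2 + (1 / 2) ^ (k + 1))) w.prod)
    (fun u => ∀ c ∈ C, c ∈ u)
    ⟨by simp, fun m => by
      obtain ⟨w, h1, h2, h3⟩ := hcon m
      exact ⟨w, h1, h2, by norm_num; exact h3⟩⟩ (by
      rintro k w ⟨h1, h2⟩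
      obtain ⟨u, hu1, hu2, hu3⟩ := step w.prod _ (ε * (1 / 2 + (1 / 2) ^ (k + 1 + 1))) (by
        have : (0 : ℝ) < (1 / 2) ^ (k + 1) := by positivity
        rw [pow_succ (1 / 2 : ℝ) (k + 1)]
        nlinarith) h2
      refine ⟨u, List.ne_nil_of_mem (hu2 c hc), hu2, ?_, by rwa [List.prod_append]⟩
      intro a ha
      rcases List.mem_append.1 ha with ha | ha
      exacts [h1 a ha, hu1 a ha])
  have hs : ∀ i, s i ∈ C := fun i =>
    (hQ (i + 1)).1 _ (List.mem_map.2 ⟨i, List.mem_range.2 hn.le_apply, rfl⟩)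
  obtain ⟨L, hL⟩ := hC s hs
  have hfix : ∀ a ∈ C, L * a = L := by
    intro a ha
    have h1 : Tendsto (fun m => ((List.range m).map s).prod * a -
        ((List.range (m + 1)).map s).prod) atTop (𝓝 (L * a - L)) :=
      (hL.mul_const a).sub (hL.comp (tendsto_add_atTop_nat 1))
    -- Whenever the next letter is `a`, the next partial product is the present one times `a`.
    have h2 : ∃ᶠ m in atTop, ((List.range m).map s).prod * a -
        ((List.range (m + 1)).map s).prod ∈ ({0} : Set 𝔸) := by
      refine frequently_atTop.2 fun k => ?_
      obtain ⟨u, hu, hu'⟩ := hrec k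
      obtain ⟨i, hi, rfl⟩ := hu' a (hu a ha)
      exact ⟨i, hi, by simp [List.range_succ]⟩
    exact sub_eq_zero.1 (isClosed_singleton.mem_of_frequently_of_tendsto h2 h1)
  have hLP := hP.eq_of_fixed L hfix
  have h1 : Tendsto (fun k => ‖((List.range (n k)).map s).prod * (1 - P)‖ * K) atTop
      (𝓝 (‖L * (1 - P)‖ * K)) :=
    (((hL.comp hn.tendsto_atTop).mul_const _).norm).mul_const _
  have h2 : ε / 2 ≤ ‖L * (1 - P)‖ * K := by
    refine ge_of_tendsto' h1 fun k => ?_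
    obtain ⟨w, hw, -, h⟩ := (hQ k).2 0
    have e : ((List.range (n k)).map s).prod * w.prod - ((List.range (n k)).map s).prod * P =
        ((List.range (n k)).map s).prod * (1 - P) * w.prod := by
      rw [mul_sub, sub_mul, mul_one, mul_assoc _ P, hP.mul_prod w hw]
    rw [e] at h
    have h3 := (norm_mul_le (((List.range (n k)).map s).prod * (1 - P)) w.prod).trans
      (mul_le_mul_of_nonneg_left (hK w hw) (norm_nonneg _))
    have : (0 : ℝ) < (1 / 2) ^ (k + 1) := by positivity
    nlinarith
  rw [mul_sub, mul_one, hLP, sub_self, norm_zero, zero_mul] at h2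
  linarith

end Algebra

/-! ### Variation of growing products -/

theorem sublist_filter_time {α : Type*} (l : List (α × ℕ)) {i j : ℕ} (h : i ≤ j) :
    ((l.filter (·.2 ≤ i)).map Prod.fst).Sublist ((l.filter (·.2 ≤ j)).map Prod.fst) :=
  (List.monotone_filter_right l fun x hx => by
    simp only [decide_eq_true_eq] at hx ⊢
    exact hx.trans h).map _

section Variation

variable {𝔸 : Type*} [NormedRing 𝔸]

/-- The product of the letters of `l` that have appeared by the time `i`. -/
def timedProd (l : List (𝔸 × ℕ)) (i : ℕ) : 𝔸 :=
  ((l.filter (·.2 ≤ i)).map Prod.fst).prod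

/-- The variation of `timedProd l` between the times `s` and `N`. -/
noncomputable def timedVar (l : List (𝔸 × ℕ)) (s N : ℕ) : ℝ :=
  ∑ i ∈ Finset.Ico s N, ‖timedProd l (i + 1) - timedProd l i‖

theorem timedProd_append (l₁ l₂ : List (𝔸 × ℕ)) (i : ℕ) :
    timedProd (l₁ ++ l₂) i = timedProd l₁ i * timedProd l₂ i := by
  simp [timedProd]

theorem timedProd_filter {l : List (𝔸 × ℕ)} {i j : ℕ} (h : i ≤ j) :
    timedProd (l.filter (·.2 ≤ j)) i = timedProd l i := by
  rw [timedProd, timedProd, List.filter_filter]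
  congr 2
  refine List.filter_congr fun x _ => ?_
  rw [← Bool.decide_and]
  exact decide_eq_decide.2 ⟨fun hx => hx.1, fun hx => ⟨hx, hx.trans h⟩⟩

theorem timedVar_filter (l : List (𝔸 × ℕ)) (s N : ℕ) :
    timedVar (l.filter (·.2 ≤ N)) s N = timedVar l s N := by
  refine Finset.sum_congr rfl fun i hi => ?_
  have := (Finset.mem_Ico.1 hi).2
  rw [timedProd_filter this, timedProd_filter this.le]

theorem timedVar_le_zero (l : List (𝔸 × ℕ)) (s N : ℕ) : timedVar l s N ≤ timedVar l 0 N :=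
  Finset.sum_le_sum_of_subset_of_nonneg (Finset.Ico_subset_Ico_left (Nat.zero_le s))
    fun _ _ _ => norm_nonneg _

theorem timedVar_nil (s N : ℕ) : timedVar ([] : List (𝔸 × ℕ)) s N = 0 := by
  simp [timedVar, timedProd]

theorem timedVar_singleton_le (x : 𝔸 × ℕ) (N : ℕ) : timedVar [x] 0 N ≤ ‖x.1 - 1‖ := by
  have h : ∀ i, ‖timedProd [x] (i + 1) - timedProd [x] i‖ ≤
      if x.2 - 1 = i then ‖x.1 - 1‖ else 0 := by
    intro i
    unfold timedProd
    by_cases h1 : x.2 ≤ i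
    · simp only [List.filter_cons, h1, h1.trans (Nat.le_succ i)]
      simp
      split_ifs <;> simp
    · by_cases h2 : x.2 ≤ i + 1
      · simp [h1, h2, show x.2 - 1 = i by omega]
      · simp only [List.filter_cons, h1, h2]
        simp
        split_ifs <;> simp
  refine (Finset.sum_le_sum fun i _ => h i).trans ?_
  rw [Finset.sum_ite_eq]
  split_ifs <;> simp

/-- The product rule for differences. The factor is required only on actual increments because in
the contracting case it fails for general `y`. -/
theorem timedVar_append_le {l₁ l₂ : List (𝔸 × ℕ)} {s N : ℕ} {K : ℝ}
    (h₁ : ∀ i ∈ Finset.Ico s N, ∀ y : 𝔸, y = timedProd l₂ (i + 1) - timedProd l₂ i →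
      ‖timedProd l₁ i * y‖ ≤ K * ‖y‖)
    (h₂ : ∀ i ∈ Finset.Ico s N, ∀ y : 𝔸, y = timedProd l₁ (i + 1) - timedProd l₁ i →
      ‖y * timedProd l₂ (i + 1)‖ ≤ K * ‖y‖) :
    timedVar (l₁ ++ l₂) s N ≤ K * (timedVar l₁ s N + timedVar l₂ s N) := by
  unfold timedVar
  rw [← Finset.sum_add_distrib, Finset.mul_sum]
  refine Finset.sum_le_sum fun i hi => ?_
  rw [timedProd_append, timedProd_append, mul_add]
  have e : timedProd l₁ (i + 1) * timedProd l₂ (i + 1) - timedProd l₁ i * timedProd l₂ i =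
      (timedProd l₁ (i + 1) - timedProd l₁ i) * timedProd l₂ (i + 1) +
      timedProd l₁ i * (timedProd l₂ (i + 1) - timedProd l₂ i) := by noncomm_ring
  rw [e]
  exact (norm_add_le _ _).trans (add_le_add (h₂ i hi _ rfl) (h₁ i hi _ rfl))

theorem timedVar_append_le_of_bound {C : Set 𝔸} {K : ℝ}
    (hK : ∀ w : List 𝔸, (∀ a ∈ w, a ∈ C) → ‖w.prod‖ ≤ K) {l₁ l₂ : List (𝔸 × ℕ)}
    (h₁ : ∀ x ∈ l₁, x.1 ∈ C) (h₂ : ∀ x ∈ l₂, x.1 ∈ C) (s N : ℕ) :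
    timedVar (l₁ ++ l₂) s N ≤ K * (timedVar l₁ s N + timedVar l₂ s N) := by
  have h : ∀ l : List (𝔸 × ℕ), (∀ x ∈ l, x.1 ∈ C) → ∀ i, ‖timedProd l i‖ ≤ K := by
    intro l hl i
    refine hK _ fun a ha => ?_
    obtain ⟨x, hx, rfl⟩ := List.mem_map.1 ha
    exact hl x (List.mem_of_mem_filter hx)
  refine timedVar_append_le (fun i _ y _ => ?_) (fun i _ y _ => ?_)
  · exact (norm_mul_le _ _).trans (mul_le_mul_of_nonneg_right (h _ h₁ i) (norm_nonneg _))
  · rw [mul_comm K]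
    exact (norm_mul_le _ _).trans (mul_le_mul_of_nonneg_left (h _ h₂ _) (norm_nonneg _))

/-- Since `P` absorbs every product, it kills increments from either side. Multiplying an increment
by a product is thus multiplying it by that product minus `P`, which has norm at most `ε` from time
`s` on. -/
theorem timedVar_append_le_of_blocks {C : Set 𝔸} {P : 𝔸} (hP : IsLimitProjection C P) {ε : ℝ}
    {m : ℕ} (hm : ∀ w : List 𝔸, (∀ a ∈ w, a ∈ C) → HasBlocks C m w → ‖w.prod - P‖ ≤ ε)
    {l₁ l₂ : List (𝔸 × ℕ)} (h₁ : ∀ x ∈ l₁, x.1 ∈ C) (h₂ : ∀ x ∈ l₂, x.1 ∈ C) {s : ℕ} (N : ℕ)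
    (hb₁ : HasBlocks C m ((l₁.filter (·.2 ≤ s)).map Prod.fst))
    (hb₂ : HasBlocks C m ((l₂.filter (·.2 ≤ s)).map Prod.fst)) :
    timedVar (l₁ ++ l₂) s N ≤ ε * (timedVar l₁ s N + timedVar l₂ s N) := by
  have hl : ∀ l : List (𝔸 × ℕ), (∀ x ∈ l, x.1 ∈ C) → ∀ i,
      ∀ a ∈ (l.filter (·.2 ≤ i)).map Prod.fst, a ∈ C := by
    intro l hl i a ha
    obtain ⟨x, hx, rfl⟩ := List.mem_map.1 ha
    exact hl x (List.mem_of_mem_filter hx)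
  have hn : ∀ l : List (𝔸 × ℕ), (∀ x ∈ l, x.1 ∈ C) →
      HasBlocks C m ((l.filter (·.2 ≤ s)).map Prod.fst) → ∀ i, s ≤ i →
      ‖timedProd l i - P‖ ≤ ε := fun l h hb i hi =>
    hm _ (hl l h i) (hb.sublist (sublist_filter_time l hi))
  have hPl : ∀ l : List (𝔸 × ℕ), (∀ x ∈ l, x.1 ∈ C) → ∀ i, P * timedProd l i = P :=
    fun l h i => hP.mul_prod _ (hl l h i)
  have hPr : ∀ l : List (𝔸 × ℕ), (∀ x ∈ l, x.1 ∈ C) → ∀ i, timedProd l i * P = P :=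
    fun l h i => hP.prod_mul _ (hl l h i)
  refine timedVar_append_le (fun i hi y hy => ?_) (fun i hi y hy => ?_)
  · have h0 : P * y = 0 := by rw [hy, mul_sub, hPl _ h₂, hPl _ h₂, sub_self]
    have e : timedProd l₁ i * y = (timedProd l₁ i - P) * y := by rw [sub_mul, h0, sub_zero]
    rw [e]
    exact (norm_mul_le _ _).trans (mul_le_mul_of_nonneg_right
      (hn _ h₁ hb₁ i (Finset.mem_Ico.1 hi).1) (norm_nonneg _))
  · have h0 : y * P = 0 := by rw [hy, sub_mul, hPr _ h₁, hPr _ h₁, sub_self]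
    have e : y * timedProd l₂ (i + 1) = y * (timedProd l₂ (i + 1) - P) := by
      rw [mul_sub, h0, sub_zero]
    rw [e, mul_comm ε]
    exact (norm_mul_le _ _).trans (mul_le_mul_of_nonneg_left
      (hn _ h₂ hb₂ (i + 1) ((Finset.mem_Ico.1 hi).1.trans (Nat.le_succ i))) (norm_nonneg _))

/-- Cut the word at its shortest complete prefix: this leaves a word over a smaller alphabet, one
letter, and a remainder with one block fewer to avoid. -/
theorem exists_timedVar_le_of_not_hasBlocks [DecidableEq 𝔸] {C : Finset 𝔸} {K : ℝ}
    (hK : ∀ w : List 𝔸, (∀ a ∈ w, a ∈ C) → ‖w.prod‖ ≤ K) {V : ℝ} (hV0 : 0 ≤ V)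
    (hV : ∀ c ∈ C, ∀ (N : ℕ) (l : List (𝔸 × ℕ)), (∀ x ∈ l, x.1 ∈ C.erase c) →
      timedVar l 0 N ≤ V) (hC : C.Nonempty) (m : ℕ) :
    ∃ b : ℝ, 0 ≤ b ∧ ∀ (N : ℕ) (l : List (𝔸 × ℕ)), (∀ x ∈ l, x.1 ∈ C) →
      ¬ HasBlocks (C : Set 𝔸) m (l.map Prod.fst) → timedVar l 0 N ≤ b := by
  have hK0 : 0 ≤ K := (norm_nonneg _).trans (hK [] (by simp))
  have hinc : ∀ (N : ℕ) (l : List (𝔸 × ℕ)), (∀ x ∈ l, x.1 ∈ C) →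
      ¬ (∀ c ∈ C, c ∈ l.map Prod.fst) → timedVar l 0 N ≤ V := by
    intro N l hl h
    push Not at h
    obtain ⟨c, hc, hcl⟩ := h
    refine hV c hc N l fun x hx => Finset.mem_erase.2 ⟨?_, hl x hx⟩
    rintro rfl
    exact hcl (List.mem_map.2 ⟨x, hx, rfl⟩)
  induction m with
  | zero => exact ⟨0, le_rfl, fun N l _ h => absurd trivial h⟩
  | succ m ih =>
    obtain ⟨b, hb0, hb⟩ := ih
    refine ⟨V + K * (V + K * ((K + K) + b)), by positivity, fun N l hl hnb => ?_⟩
    by_cases hcompl : ∀ c ∈ C, c ∈ l.map Prod.fst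
    swap
    · exact (hinc N l hl hcompl).trans (le_add_of_nonneg_right (by positivity))
    obtain ⟨u, x, v, rfl, hu, hux⟩ := exists_first_prefix
      (fun l : List (𝔸 × ℕ) => ∀ c ∈ C, c ∈ l.map Prod.fst)
      (by obtain ⟨c, hc⟩ := hC
          exact fun h => by simpa using h c hc) l hcompl
    have hlu : ∀ y ∈ u, y.1 ∈ C := fun y hy => hl y (by simp [hy])
    have hlx : ∀ y ∈ [x], y.1 ∈ C := fun y hy => hl y (by simp [List.mem_singleton.1 hy])
    have hlv : ∀ y ∈ v, y.1 ∈ C := fun y hy => hl y (by simp [hy])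
    have h1 := hinc N u hlu hu
    have h2 : timedVar [x] 0 N ≤ K + K := by
      refine (timedVar_singleton_le x N).trans ((norm_sub_le _ _).trans (add_le_add ?_ ?_))
      · simpa using hK [x.1] (by simpa using hlx x)
      · simpa using hK [] (by simp)
    have h3 := hb N v hlv fun h => hnb ⟨(u ++ [x]).map Prod.fst, v.map Prod.fst, by simp,
      fun c hc => hux c hc, h⟩
    have h4 := timedVar_append_le_of_bound (C := (C : Set 𝔸)) hK hlx hlv 0 N
    have h5 := timedVar_append_le_of_bound (C := (C : Set 𝔸)) hK hlu
      (l₂ := [x] ++ v) (fun y hy => hl y (by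
        rcases List.mem_append.1 hy with h | h
        · simp [List.mem_singleton.1 h]
        · simp [h])) 0 N
    rw [List.singleton_append] at h4 h5
    calc timedVar (u ++ x :: v) 0 N ≤ K * (timedVar u 0 N + timedVar (x :: v) 0 N) := h5
      _ ≤ K * (V + K * ((K + K) + b)) := by gcongr; exact h4.trans (by gcongr)
      _ ≤ _ := le_add_of_nonneg_left hV0

/-- The time at which the visible word first has `m + m` blocks divides the variation into a part
bounded by `b`, one jump of at most `K + K`, and a part contracted by the two-halves estimate. -/
theorem exists_timedVar_le [NormedAlgebra ℝ 𝔸] [FiniteDimensional ℝ 𝔸] {Sg : Set 𝔸}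
    (hfin : Sg.Finite) (hconv : RightConvergent Sg)
    (hproj : ∀ C ⊆ Sg, ∃ P, IsLimitProjection C P) (C : Finset 𝔸) (hC : (C : Set 𝔸) ⊆ Sg) :
    ∃ V : ℝ, 0 ≤ V ∧ ∀ (N : ℕ) (l : List (𝔸 × ℕ)), (∀ x ∈ l, x.1 ∈ C) →
      timedVar l 0 N ≤ V := by
  classical
  induction C using Finset.strongInduction with
  | H C ih =>
  rcases C.eq_empty_or_nonempty with rfl | hne
  · refine ⟨0, le_rfl, fun N l hl => ?_⟩
    obtain rfl : l = [] := List.eq_nil_iff_forall_not_mem.2 fun x hx => by simpa using hl x hx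
    exact (timedVar_nil 0 N).le
  obtain ⟨K, hK1, hK⟩ := hconv.exists_bound hfin
  replace hK : ∀ w : List 𝔸, (∀ a ∈ w, a ∈ (C : Set 𝔸)) → ‖w.prod‖ ≤ K :=
    fun w hw => hK w fun a ha => hC (hw a ha)
  obtain ⟨P, hP⟩ := hproj C hC
  -- Each of the two halves contributes a quarter of the supremum, so half of it remains to be
  -- absorbed.
  obtain ⟨m, hm⟩ := (hconv.mono hC).exists_blocks hK hP (show (0 : ℝ) < 1 / 4 by norm_num)
  have hV : ∀ c, ∃ V : ℝ, 0 ≤ V ∧ (c ∈ C → ∀ (N : ℕ) (l : List (𝔸 × ℕ)),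
      (∀ x ∈ l, x.1 ∈ C.erase c) → timedVar l 0 N ≤ V) := by
    intro c
    by_cases hc : c ∈ C
    · obtain ⟨V, h0, h⟩ := ih (C.erase c) (Finset.erase_ssubset hc)
        (fun a ha => hC (Finset.mem_of_mem_erase ha))
      exact ⟨V, h0, fun _ => h⟩
    · exact ⟨0, le_rfl, fun h => absurd h hc⟩
  choose Vf hVf0 hVf using hV
  obtain ⟨b, hb0, hb⟩ := exists_timedVar_le_of_not_hasBlocks hK
    (Finset.sum_nonneg fun c (_ : c ∈ C) => hVf0 c)
    (fun c hc N l hl => (hVf c hc N l hl).trans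
      (Finset.single_le_sum (f := Vf) (fun c _ => hVf0 c) hc)) hne (m + m)
  have hlet : ∀ l : List (𝔸 × ℕ), (∀ x ∈ l, x.1 ∈ C) → ∀ i,
      ∀ a ∈ (l.filter (·.2 ≤ i)).map Prod.fst, a ∈ (C : Set 𝔸) := by
    intro l hl i a ha
    obtain ⟨x, hx, rfl⟩ := List.mem_map.1 ha
    exact hl x (List.mem_of_mem_filter hx)
  have hstep : ∀ l : List (𝔸 × ℕ), (∀ x ∈ l, x.1 ∈ C) → ∀ i,
      ‖timedProd l (i + 1) - timedProd l i‖ ≤ K + K := fun l hl i =>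
    (norm_sub_le _ _).trans (add_le_add (hK _ (hlet l hl _)) (hK _ (hlet l hl _)))
  refine ⟨2 * (b + (K + K)), by positivity, fun N => ?_⟩
  -- For fixed `N` the supremum is finite by the crude bound `K + K` per step, so it may be
  -- subtracted; the resulting bound no longer depends on `N`.
  set T : Set ℝ := {t | ∃ l : List (𝔸 × ℕ), (∀ x ∈ l, x.1 ∈ C) ∧ timedVar l 0 N = t} with hT
  have hTb : BddAbove T := by
    refine ⟨∑ i ∈ Finset.Ico 0 N, (K + K), ?_⟩
    rintro _ ⟨l, hl, rfl⟩
    exact Finset.sum_le_sum fun i _ => hstep l hl i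
  have hTn : T.Nonempty := ⟨_, [], by simp, rfl⟩
  have hle : ∀ l : List (𝔸 × ℕ), (∀ x ∈ l, x.1 ∈ C) → timedVar l 0 N ≤ sSup T :=
    fun l hl => le_csSup hTb ⟨l, hl, rfl⟩
  have hT0 : 0 ≤ sSup T := by simpa [timedVar_nil] using hle [] (by simp)
  have hsup : sSup T ≤ b + (K + K) + sSup T / 2 := by
    refine csSup_le hTn ?_
    rintro _ ⟨l, hl, rfl⟩
    have hsmall : ∀ j, ¬ HasBlocks (C : Set 𝔸) (m + m) ((l.filter (·.2 ≤ j)).map Prod.fst) →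
        timedVar l 0 j ≤ b := fun j hj => by
      rw [← timedVar_filter]
      exact hb j _ (fun x hx => hl x (List.mem_of_mem_filter hx)) hj
    have hlarge : ∀ s, HasBlocks (C : Set 𝔸) (m + m) ((l.filter (·.2 ≤ s)).map Prod.fst) →
        timedVar l s N ≤ sSup T / 2 := fun s hs => by
      obtain ⟨u, v, huv, hu, hv⟩ := hs.exists_append
      obtain ⟨u', v', huv', rfl, rfl⟩ := List.map_eq_append_iff.1 huv
      -- The cut of the word visible at time `s` lifts to a cut of the whole timed word.
      obtain ⟨l₁, l₂, rfl, rfl, rfl⟩ := List.filter_eq_append_iff.1 huv'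
      have hl₁ : ∀ x ∈ l₁, x.1 ∈ C := fun x hx => hl x (by simp [hx])
      have hl₂ : ∀ x ∈ l₂, x.1 ∈ C := fun x hx => hl x (by simp [hx])
      have h1 := timedVar_append_le_of_blocks hP hm hl₁ hl₂ N hu hv
      have h2 := (timedVar_le_zero l₁ s N).trans (hle l₁ hl₁)
      have h3 := (timedVar_le_zero l₂ s N).trans (hle l₂ hl₂)
      linarith
    by_cases hex : ∃ s, HasBlocks (C : Set 𝔸) (m + m) ((l.filter (·.2 ≤ s)).map Prod.fst)
    swap
    · push Not at hex
      have := hsmall N (hex N)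
      linarith
    have hs := Nat.find_spec hex
    have hmin := fun j => Nat.find_min hex (m := j)
    generalize Nat.find hex = s at hs hmin
    rcases lt_or_ge N s with hNs | hNs
    · have := hsmall N (hmin N hNs)
      linarith
    have hL := hlarge s hs
    rcases Nat.eq_zero_or_pos s with rfl | hs0
    · linarith
    obtain ⟨j, rfl⟩ : ∃ j, s = j + 1 := ⟨s - 1, by omega⟩
    have h1 := hsmall j (hmin j (Nat.lt_succ_self j))
    have h2 := hstep l hl j
    have e : timedVar l 0 N = timedVar l 0 j + ‖timedProd l (j + 1) - timedProd l j‖ +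
        timedVar l (j + 1) N := by
      unfold timedVar
      rw [← Finset.sum_Ico_succ_top (Nat.zero_le j), Finset.sum_Ico_consecutive _ (Nat.zero_le _) hNs]
    linarith
  intro l hl
  have := hle l hl
  linarith

end Variation

/-! ### Products over finite parts of a linearly ordered set -/

theorem exists_finset_image_superset {R α : Type*} {A : R → α} {C : Set α} (hC : C.Finite)
    {X : Set R} (h : C ⊆ A '' X) : ∃ G : Finset R, (G : Set R) ⊆ X ∧ C ⊆ A '' G := by
  classical
  lift C to Finset α using hC
  obtain ⟨G, hG, rfl⟩ := Finset.subset_set_image_iff.1 h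
  exact ⟨G, hG, by simp⟩

section Order

variable {R : Type*} [LinearOrder R]

theorem sort_filter (F : Finset R) (p : R → Prop) [DecidablePred p] :
    (F.filter p).sort (· ≤ ·) = (F.sort (· ≤ ·)).filter p := by
  have h1 : ((F.sort (· ≤ ·)).filter p).Nodup := (F.sort_nodup (· ≤ ·)).filter _
  have h2 : ((F.sort (· ≤ ·)).filter p).toFinset = F.filter p := by
    ext x; simp
  rw [← h2]
  exact (List.toFinset_sort _ h1).2 ((F.pairwise_sort (· ≤ ·)).filter _)

theorem sort_union {F G : Finset R} (h : ∀ a ∈ F, ∀ b ∈ G, a < b) :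
    (F ∪ G).sort (· ≤ ·) = F.sort (· ≤ ·) ++ G.sort (· ≤ ·) := by
  have h1 : (F.sort (· ≤ ·) ++ G.sort (· ≤ ·)).Nodup :=
    (F.sort_nodup _).append (G.sort_nodup _) fun x hx hy =>
      lt_irrefl x (h x (by simpa using hx) x (by simpa using hy))
  have h2 : (F.sort (· ≤ ·) ++ G.sort (· ≤ ·)).toFinset = F ∪ G := by
    ext x; simp
  rw [← h2]
  exact (List.toFinset_sort _ h1).2 (List.pairwise_append.2
    ⟨F.pairwise_sort _, G.pairwise_sort _, fun a ha b hb =>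
      (h a (by simpa using ha) b (by simpa using hb)).le⟩)

theorem sort_sublist {F G : Finset R} (h : F ⊆ G) :
    (F.sort (· ≤ ·)).Sublist (G.sort (· ≤ ·)) := by
  have : F = G.filter (· ∈ F) := by
    ext x; simpa using fun hx => h hx
  rw [this, sort_filter]
  exact List.filter_sublist

open Classical in
/-- The ordered product over the part of the finite set `F` that lies in `S`. -/
noncomputable def finiteProd {𝔸 : Type*} [Monoid 𝔸] (A : R → 𝔸) (S : Set R) (F : Finset R) : 𝔸 :=
  (((F.filter (· ∈ S)).sort (· ≤ ·)).map A).prod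

theorem finiteProd_iUnion {𝔸 : Type*} [Monoid 𝔸] (A : R → 𝔸) (F : Finset R) {k : ℕ}
    (T : Fin k → Set R) (hlt : ∀ i j, i < j → ∀ a ∈ T i, ∀ b ∈ T j, a < b) :
    finiteProd A (⋃ i, T i) F = (List.ofFn fun i => finiteProd A (T i) F).prod := by
  classical
  induction k with
  | zero => simp [finiteProd]
  | succ k ih =>
    rw [List.ofFn_succ, List.prod_cons, ← ih (fun i => T i.succ)
      fun i j hij => hlt _ _ (Fin.succ_lt_succ_iff.2 hij)]
    unfold finiteProd
    rw [← List.prod_append, ← List.map_append, ← sort_union]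
    · congr 3
      ext x
      simp only [Finset.mem_filter, Finset.mem_union, Set.mem_iUnion, Fin.exists_fin_succ]
      tauto
    · intro a ha b hb
      obtain ⟨-, ha⟩ := Finset.mem_filter.1 ha
      obtain ⟨-, hb⟩ := Finset.mem_filter.1 hb
      obtain ⟨i, hi⟩ := Set.mem_iUnion.1 hb
      exact hlt 0 i.succ (Fin.succ_pos i) a ha b hi

theorem tendsto_finiteProd_of_finite {𝔸 : Type*} [Monoid 𝔸] [TopologicalSpace 𝔸] (A : R → 𝔸)
    {S : Set R} (hS : S.Finite) :
    Tendsto (finiteProd A S) atTop (𝓝 ((hS.toFinset.sort (· ≤ ·)).map A).prod) := by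
  classical
  refine tendsto_const_nhds.congr' ?_
  filter_upwards [eventually_ge_atTop hS.toFinset] with F hF
  have : F.filter (· ∈ S) = hS.toFinset := by
    ext x
    simpa using fun hx => hF (hS.mem_toFinset.2 hx)
  rw [finiteProd, this]

/-- Disjoint intervals are linearly ordered. With one point marked in each, the interval with the
least mark lies below all others, and finitely many of its points form the first block. -/
theorem exists_finset_hasBlocks {α : Type*} {A : R → α} {C : Set α} (hC : C.Finite)
    (hne : C.Nonempty) {S : Set R} (m : ℕ) (F : Finset (Set R)) (hm : F.card = m)
    (hsub : ∀ T ∈ F, T ⊆ S)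
    (hconv : ∀ T ∈ F, ∀ a ∈ T, ∀ b ∈ T, ∀ g ∈ S, a < g → g < b → g ∈ T)
    (himg : ∀ T ∈ F, C ⊆ A '' T) (hdisj : (F : Set (Set R)).PairwiseDisjoint id) :
    ∃ G : Finset R, (∀ x ∈ G, ∃ T ∈ F, x ∈ T) ∧
      HasBlocks C m ((G.sort (· ≤ ·)).map A) := by
  classical
  induction m generalizing F with
  | zero => exact ⟨∅, by simp, trivial⟩
  | succ m ih =>
    have ht : ∀ T, ∃ t, T ∈ F → t ∈ T := by
      intro T
      by_cases hT : T ∈ F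
      · obtain ⟨c, hc⟩ := hne
        obtain ⟨t, ht, -⟩ := himg T hT hc
        exact ⟨t, fun _ => ht⟩
      · obtain ⟨T', hT'⟩ := Finset.card_pos.1 (by omega : 0 < F.card)
        obtain ⟨c, hc⟩ := hne
        obtain ⟨t, -⟩ := himg T' hT' hc
        exact ⟨t, fun h => absurd h hT⟩
    choose t ht using ht
    obtain ⟨T, hT, hmin⟩ := Finset.exists_min_image F t (Finset.card_pos.1 (by omega))
    obtain ⟨G, hG, hGb⟩ := ih (F.erase T) (by rw [Finset.card_erase_of_mem hT]; omega)
      (fun X hX => hsub X (Finset.mem_of_mem_erase hX))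
      (fun X hX => hconv X (Finset.mem_of_mem_erase hX))
      (fun X hX => himg X (Finset.mem_of_mem_erase hX))
      (hdisj.subset (by simp))
    obtain ⟨G', hG', hG'C⟩ := exists_finset_image_superset hC (himg T hT)
    have hlt : ∀ a ∈ G', ∀ b ∈ G, a < b := by
      intro a ha b hb
      obtain ⟨X, hX, hbX⟩ := hG b hb
      obtain ⟨hXT, hXF⟩ := Finset.mem_erase.1 hX
      have hdis : Disjoint T X := hdisj hT hXF hXT.symm
      have haT := hG' ha
      have hne : ∀ x ∈ T, ∀ y ∈ X, x ≠ y := fun x hx y hy => by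
        rintro rfl
        exact Set.disjoint_left.1 hdis hx hy
      have htX : t T < t X := lt_of_le_of_ne (hmin X hXF) (hne _ (ht T hT) _ (ht X hXF))
      by_contra! hba
      have hba' : b < a := lt_of_le_of_ne hba (hne a haT b hbX).symm
      rcases lt_or_gt_of_ne (hne _ (ht T hT) b hbX) with h | h
      · exact hne b (hconv T hT _ (ht T hT) a haT b (hsub X hXF hbX) h hba') b hbX rfl
      · exact hne (t T) (ht T hT) (t T)
          (hconv X hXF b hbX _ (ht X hXF) (t T) (hsub T hT (ht T hT)) h htX) rfl
    refine ⟨G' ∪ G, fun x hx => ?_, ?_⟩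
    · rcases Finset.mem_union.1 hx with hx | hx
      · exact ⟨T, hT, hG' hx⟩
      · obtain ⟨X, hX, hxX⟩ := hG x hx
        exact ⟨X, Finset.mem_of_mem_erase hX, hxX⟩
    · rw [sort_union hlt, List.map_append]
      refine ⟨_, _, rfl, fun c hc => ?_, hGb⟩
      obtain ⟨x, hx, rfl⟩ := hG'C hc
      exact List.mem_map.2 ⟨x, by simpa using hx, rfl⟩

theorem hasBlocks_empty {α : Type*} (m : ℕ) (w : List α) : HasBlocks (∅ : Set α) m w := by
  induction m with
  | zero => trivial
  | succ m ih => exact ⟨[], w, rfl, by simp, ih⟩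

theorem mem_of_mem_sort_map {𝔸 : Type*} {A : R → 𝔸} {S : Set R} {G : Finset R} (hG : ∀ x ∈ G, x ∈ S) :
    ∀ a ∈ (G.sort (· ≤ ·)).map A, a ∈ A '' S := by
  intro a ha
  obtain ⟨x, hx, rfl⟩ := List.mem_map.1 ha
  exact ⟨x, hG x (by simpa using hx), rfl⟩

/-! ### Variation and convergence of the finite products -/

section Algebra

variable {𝔸 : Type*} [NormedRing 𝔸]

theorem exists_finiteProd_variation_le [NormedAlgebra ℝ 𝔸] [FiniteDimensional ℝ 𝔸] {Sg : Set 𝔸}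
    (hfin : Sg.Finite) (hconv : RightConvergent Sg)
    (hproj : ∀ C ⊆ Sg, ∃ P, IsLimitProjection C P) :
    ∃ V : ℝ, ∀ (R : Type*) [LinearOrder R] (A : R → 𝔸), (∀ r, A r ∈ Sg) →
      ∀ S : ℕ → Set R, Monotone S → ∀ (F : Finset R) (N : ℕ),
        ∑ i ∈ Finset.range N, ‖finiteProd A (S (i + 1)) F - finiteProd A (S i) F‖ ≤ V := by
  classical
  obtain ⟨V, -, hV⟩ := exists_timedVar_le hfin hconv hproj hfin.toFinset (by simp)
  refine ⟨V, fun R _ A hA S hS F N => ?_⟩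
  -- The arrival time of `r`; the value `0` for points that never arrive is harmless, since only
  -- points of `S N` are used.
  let τ : R → ℕ := fun r => sInf {i | r ∈ S i}
  have hτ : ∀ r ∈ S N, ∀ i, τ r ≤ i ↔ r ∈ S i := fun r hr i =>
    ⟨fun h => hS h (Nat.sInf_mem (s := {i | r ∈ S i}) ⟨N, hr⟩), fun h => Nat.sInf_le h⟩
  let l : List (𝔸 × ℕ) := ((F.filter (· ∈ S N)).sort (· ≤ ·)).map fun r => (A r, τ r)
  have hl : ∀ i ≤ N, timedProd l i = finiteProd A (S i) F := by
    intro i hi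
    have h1 : F.filter (· ∈ S i) = (F.filter (· ∈ S N)).filter (τ · ≤ i) := by
      ext r
      simp only [Finset.mem_filter, and_assoc, and_congr_right_iff]
      exact fun _ => ⟨fun h => ⟨hS hi h, (hτ r (hS hi h) i).2 h⟩, fun h => (hτ r h.1 i).1 h.2⟩
    rw [finiteProd, h1, sort_filter, timedProd, List.filter_map, List.map_map]
    rfl
  refine le_trans (le_of_eq ?_) (hV N l fun x hx => ?_)
  · rw [timedVar, ← Finset.range_eq_Ico]
    refine Finset.sum_congr rfl fun i hi => ?_
    have := Finset.mem_range.1 hi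
    rw [hl _ this, hl _ this.le]
  · obtain ⟨r, -, rfl⟩ := List.mem_map.1 hx
    simpa using hA r

theorem tendsto_finiteProd_of_intervals [NormedAlgebra ℝ 𝔸] [FiniteDimensional ℝ 𝔸] {A : R → 𝔸}
    {S : Set R} (hfin : (A '' S).Finite) (hconv : RightConvergent (A '' S)) {P : 𝔸}
    (hP : IsLimitProjection (A '' S) P)
    (hI : ∀ m, ∃ F : Finset (Set R), F.card = m ∧ (∀ T ∈ F, T ⊆ S) ∧
      (∀ T ∈ F, ∀ a ∈ T, ∀ b ∈ T, ∀ g ∈ S, a < g → g < b → g ∈ T) ∧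
      (∀ T ∈ F, A '' S ⊆ A '' T) ∧ (F : Set (Set R)).PairwiseDisjoint id) :
    Tendsto (finiteProd A S) atTop (𝓝 P) := by
  classical
  obtain ⟨K, -, hK⟩ := hconv.exists_bound hfin
  refine Metric.tendsto_atTop.2 fun ε hε => ?_
  obtain ⟨m, hm⟩ := hconv.exists_blocks hK hP (half_pos hε)
  obtain ⟨G, hGS, hG⟩ : ∃ G : Finset R, (∀ x ∈ G, x ∈ S) ∧
      HasBlocks (A '' S) m ((G.sort (· ≤ ·)).map A) := by
    rcases (A '' S).eq_empty_or_nonempty with h | h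
    · exact ⟨∅, by simp, by rw [h]; exact hasBlocks_empty m _⟩
    obtain ⟨F, hcard, hsub, hcv, himg, hdisj⟩ := hI m
    obtain ⟨G, hG, hb⟩ := exists_finset_hasBlocks hfin h m F hcard hsub hcv himg hdisj
    refine ⟨G, fun x hx => ?_, hb⟩
    obtain ⟨T, hT, hxT⟩ := hG x hx
    exact hsub T hT hxT
  refine ⟨G, fun F hF => ?_⟩
  rw [dist_eq_norm]
  refine (hm _ (mem_of_mem_sort_map (by simp)) (hG.sublist
    ((sort_sublist fun x hx => ?_).map A))).trans_lt (half_lt_self hε)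
  exact Finset.mem_filter.2 ⟨hF hx, hGS x hx⟩

theorem tendsto_finiteProd_iUnion {A : R → 𝔸} {k : ℕ} {T : Fin k → Set R} {P : Fin k → 𝔸}
    (hlt : ∀ i j, i < j → ∀ a ∈ T i, ∀ b ∈ T j, a < b)
    (h : ∀ i, Tendsto (finiteProd A (T i)) atTop (𝓝 (P i))) :
    Tendsto (finiteProd A (⋃ i, T i)) atTop (𝓝 (List.ofFn P).prod) := by
  rw [funext fun F => finiteProd_iUnion A F T hlt]
  simp only [List.ofFn_eq_map]
  exact tendsto_list_prod _ fun i _ => h i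

end Algebra

/-! ### Cutting into incomplete intervals -/

/-- `S` is a union of finitely many adjacent parts on none of which `A` takes all values in `C`. -/
def IsCuttable {α : Type*} (A : R → α) (C : Set α) (S : Set R) : Prop :=
  ∃ l : List (Set R), l.Pairwise (fun X Y => ∀ a ∈ X, ∀ b ∈ Y, a < b) ∧
    (∀ X ∈ l, ¬ C ⊆ A '' X) ∧ ∀ x, x ∈ S ↔ ∃ X ∈ l, x ∈ X

theorem isCuttable_of_not_subset {α : Type*} {A : R → α} {C : Set α} {S : Set R}
    (h : ¬ C ⊆ A '' S) : IsCuttable A C S :=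
  ⟨[S], by simp, by simpa using h, by simp⟩

theorem IsCuttable.union {α : Type*} {A : R → α} {C : Set α} {X Y : Set R}
    (hX : IsCuttable A C X) (hY : IsCuttable A C Y) (hlt : ∀ a ∈ X, ∀ b ∈ Y, a < b) :
    IsCuttable A C (X ∪ Y) := by
  obtain ⟨l, h1, h2, h3⟩ := hX
  obtain ⟨k, g1, g2, g3⟩ := hY
  refine ⟨l ++ k, List.pairwise_append.2 ⟨h1, g1, fun T hT T' hT' a ha b hb =>
    hlt a ((h3 a).2 ⟨T, hT, ha⟩) b ((g3 b).2 ⟨T', hT', hb⟩)⟩, fun T hT => ?_, fun x => ?_⟩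
  · rcases List.mem_append.1 hT with hT | hT
    exacts [h2 T hT, g2 T hT]
  · simp only [Set.mem_union, h3, g3, List.mem_append, or_and_right, exists_or]

/-- Suppose no such split exists. The points whose lower part is incomplete form an incomplete
initial segment `L`. The rest turns out to have a least element, so it is a singleton followed by an
incomplete set, and `S` is cuttable after all. -/
theorem exists_split_of_not_isCuttable {α : Type*} {A : R → α} {C : Set α} (hC : C.Finite)
    (hne : C.Nonempty) (hnt : ∀ x, ¬ C ⊆ {A x}) {S : Set R} (hS : ¬ IsCuttable A C S) :
    ∃ X Y, X ∪ Y = S ∧ (∀ a ∈ X, ∀ b ∈ Y, a < b) ∧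
      (C ⊆ A '' X ∧ ¬ IsCuttable A C Y ∨ C ⊆ A '' Y ∧ ¬ IsCuttable A C X) := by
  by_contra! hcon
  have hcut : ∀ s, (S ∩ Set.Iic s) ∪ (S ∩ Set.Ioi s) = S := fun s => by
    rw [← Set.inter_union_distrib_left, Set.Iic_union_Ioi, Set.inter_univ]
  have hcutlt : ∀ s, ∀ a ∈ S ∩ Set.Iic s, ∀ b ∈ S ∩ Set.Ioi s, a < b :=
    fun s a ha b hb => lt_of_le_of_lt ha.2 hb.2
  have hright : ∀ s, C ⊆ A '' (S ∩ Set.Iic s) → ¬ C ⊆ A '' (S ∩ Set.Ioi s) := by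
    intro s hs hs'
    obtain ⟨h1, h2⟩ := hcon _ _ (hcut s) (hcutlt s)
    exact hS (hcut s ▸ (h2 hs').union (h1 hs) (hcutlt s))
  set L : Set R := {s | s ∈ S ∧ ¬ C ⊆ A '' (S ∩ Set.Iic s)} with hL
  have hlow : ∀ a ∈ L, ∀ b ∈ S \ L, a < b := by
    intro a ha b hb
    by_contra! hba
    exact hb.2 ⟨hb.1, fun h => ha.2 (h.trans (Set.image_mono
      (Set.inter_subset_inter_right S (Set.Iic_subset_Iic.2 hba))))⟩
  have hGne : ∀ G : Finset R, C ⊆ A '' G → G.Nonempty := by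
    rintro G hG
    obtain ⟨c, hc⟩ := hne
    obtain ⟨x, hx, -⟩ := hG hc
    exact ⟨x, hx⟩
  have hLinc : ¬ C ⊆ A '' L := by
    intro h
    obtain ⟨G, hGL, hGC⟩ := exists_finset_image_superset hC h
    -- A finite complete subset of `L` would make the lower part of its maximum complete.
    refine (hGL (G.max'_mem (hGne G hGC))).2 (hGC.trans (Set.image_mono fun x hx => ?_))
    exact ⟨(hGL hx).1, G.le_max' x hx⟩
  have hLS : L ∪ (S \ L) = S := Set.union_sdiff_cancel fun x hx => hx.1
  have hU : ¬ IsCuttable A C (S \ L) := fun h =>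
    hS (hLS ▸ (isCuttable_of_not_subset hLinc).union h hlow)
  have hUC : C ⊆ A '' (S \ L) := by
    by_contra h
    exact hU (isCuttable_of_not_subset h)
  have hU' : ∀ s ∈ S \ L, ¬ C ⊆ A '' (S ∩ Set.Ioi s) := fun s hs =>
    hright s (by_contra fun h => hs.2 ⟨hs.1, h⟩)
  obtain ⟨G, hGU, hGC⟩ := exists_finset_image_superset hC hUC
  set s := G.min' (hGne G hGC) with hs
  have hsU : s ∈ S \ L := hGU (G.min'_mem _)
  -- A smaller `x` outside `L` would have the complete set `G` above it.
  have hmin : ∀ x ∈ S \ L, s ≤ x := by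
    intro x hx
    by_contra! hxs
    exact hU' x hx (hGC.trans (Set.image_mono fun y hy =>
      ⟨(hGU hy).1, hxs.trans_le (G.min'_le y hy)⟩))
  have hUeq : {s} ∪ (S ∩ Set.Ioi s) = S \ L := by
    ext x
    constructor
    · rintro (rfl | hx)
      · exact hsU
      · exact ⟨hx.1, fun hxL => lt_asymm hx.2 (hlow x hxL s hsU)⟩
    · intro hx
      rcases (hmin x hx).eq_or_lt with h | h
      · exact Or.inl h.symm
      · exact Or.inr ⟨hx.1, h⟩
  refine hU (hUeq ▸ (isCuttable_of_not_subset ?_).union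
    (isCuttable_of_not_subset (hU' s hsU)) ?_)
  · simpa using hnt s
  · rintro _ rfl b hb
    exact hb.2

theorem exists_intervals_of_not_isCuttable {α : Type*} {A : R → α} {C : Set α} (hC : C.Finite)
    (hne : C.Nonempty) (hnt : ∀ x, ¬ C ⊆ {A x}) {S : Set R} (hS : ¬ IsCuttable A C S) (m : ℕ) :
    ∃ F : Finset (Set R), F.card = m ∧ (∀ T ∈ F, T ⊆ S) ∧
      (∀ T ∈ F, ∀ a ∈ T, ∀ b ∈ T, ∀ g ∈ S, a < g → g < b → g ∈ T) ∧
      (∀ T ∈ F, C ⊆ A '' T) ∧ (F : Set (Set R)).PairwiseDisjoint id := by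
  classical
  induction m generalizing S with
  | zero => exact ⟨∅, by simp⟩
  | succ m ih =>
    obtain ⟨Z, X, hZ, hX, hXS, hZS, hdisj, hZconv, hXconv⟩ : ∃ Z X : Set R, C ⊆ A '' Z ∧
        ¬ IsCuttable A C X ∧ X ⊆ S ∧ Z ⊆ S ∧ Disjoint Z X ∧
        (∀ a ∈ Z, ∀ b ∈ Z, ∀ g ∈ S, a < g → g < b → g ∈ Z) ∧
        (∀ a ∈ X, ∀ b ∈ X, ∀ g ∈ S, a < g → g < b → g ∈ X) := by
      obtain ⟨X, Y, rfl, hlt, h⟩ := exists_split_of_not_isCuttable hC hne hnt hS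
      have hd : Disjoint X Y := Set.disjoint_left.2 fun x hx hy => lt_irrefl x (hlt x hx x hy)
      have hXc : ∀ a ∈ X, ∀ b ∈ X, ∀ g ∈ X ∪ Y, a < g → g < b → g ∈ X :=
        fun a _ b hb g hg _ hgb => hg.resolve_right fun h => lt_asymm hgb (hlt b hb g h)
      have hYc : ∀ a ∈ Y, ∀ b ∈ Y, ∀ g ∈ X ∪ Y, a < g → g < b → g ∈ Y :=
        fun a ha b _ g hg hag _ => hg.resolve_left fun h => lt_asymm hag (hlt g h a ha)
      rcases h with ⟨h1, h2⟩ | ⟨h1, h2⟩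
      · exact ⟨X, Y, h1, h2, Set.subset_union_right, Set.subset_union_left, hd, hXc, hYc⟩
      · exact ⟨Y, X, h1, h2, Set.subset_union_left, Set.subset_union_right, hd.symm, hYc, hXc⟩
    obtain ⟨F, hcard, hsub, hconv, himg, hdis⟩ := ih hX
    have hZF : Z ∉ F := by
      intro h
      obtain ⟨c, hc⟩ := hne
      obtain ⟨z, hz, -⟩ := hZ hc
      exact Set.disjoint_left.1 hdisj hz (hsub Z h hz)
    refine ⟨insert Z F, by rw [Finset.card_insert_of_notMem hZF, hcard], ?_, ?_, ?_, ?_⟩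
    · exact Finset.forall_mem_insert _ _ _ |>.2 ⟨hZS, fun T hT => (hsub T hT).trans hXS⟩
    · exact Finset.forall_mem_insert _ _ _ |>.2 ⟨hZconv, fun T hT a ha b hb g hg hag hgb =>
        hconv T hT a ha b hb g (hXconv a (hsub T hT ha) b (hsub T hT hb) g hg hag hgb) hag hgb⟩
    · exact Finset.forall_mem_insert _ _ _ |>.2 ⟨hZ, himg⟩
    · rw [Finset.coe_insert]
      exact hdis.insert fun T hT _ => hdisj.mono_right (hsub T hT)

end Order

attribute [local instance] Matrix.linftyOpNormedRing Matrix.linftyOpNormedAlgebra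

/-! ### Matrices -/

section Matrices

variable {n : ℕ}

theorem mem_nullSpace {T : Set (Matrix (Fin n) (Fin n) ℝ)} {x : Fin n → ℝ} :
    x ∈ nullSpace T ↔ ∀ a ∈ T, a *ᵥ x = x := by
  simp only [nullSpace, Submodule.mem_iInf, LinearMap.mem_ker, Matrix.toLin'_apply,
    Matrix.sub_mulVec, Matrix.one_mulVec, sub_eq_zero]
  exact forall₂_congr fun a _ => eq_comm

theorem sub_mulVec_mem_rangeSpace {T : Set (Matrix (Fin n) (Fin n) ℝ)}
    {a : Matrix (Fin n) (Fin n) ℝ} (ha : a ∈ T) (x : Fin n → ℝ) :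
    x - a *ᵥ x ∈ rangeSpace T := by
  have h : LinearMap.range (Matrix.toLin' (1 - a)) ≤ rangeSpace T :=
    le_iSup₂_of_le a ha le_rfl
  exact h ⟨x, by simp⟩

theorem mulVec_eq_zero_of_mem_rangeSpace {T : Set (Matrix (Fin n) (Fin n) ℝ)}
    {L : Matrix (Fin n) (Fin n) ℝ} (hL : ∀ a ∈ T, L * a = L) {x : Fin n → ℝ}
    (hx : x ∈ rangeSpace T) : L *ᵥ x = 0 := by
  have h : rangeSpace T ≤ LinearMap.ker (Matrix.toLin' L) := by
    refine iSup₂_le fun a ha => ?_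
    rintro _ ⟨y, rfl⟩
    simp [Matrix.mulVec_sub, Matrix.mulVec_mulVec, hL a ha]
  simpa using h hx

theorem exists_isProjection {T : Set (Matrix (Fin n) (Fin n) ℝ)}
    (hT : IsCompl (nullSpace T) (rangeSpace T)) : ∃ P, IsProjection T P := by
  choose f hf g hg hfg using fun x : Fin n → ℝ =>
    Submodule.mem_sup.1 (show x ∈ nullSpace T ⊔ rangeSpace T by rw [hT.sup_eq_top]; trivial)
  have huniq : ∀ x y, y ∈ nullSpace T → x - y ∈ rangeSpace T → y = f x := by
    intro x y hy hxy
    have h1 : y - f x ∈ nullSpace T := sub_mem hy (hf x)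
    have h2 : y - f x ∈ rangeSpace T := by
      have : y - f x = g x - (x - y) := by
        rw [sub_sub_eq_add_sub, eq_sub_iff_add_eq, sub_add_eq_add_sub, sub_eq_iff_eq_add,
          add_right_comm, add_comm (g x), add_comm y, hfg]
      rw [this]
      exact sub_mem (hg x) hxy
    exact sub_eq_zero.1 (Submodule.disjoint_def.1 hT.disjoint _ h1 h2)
  have hsub : ∀ x, x - f x ∈ rangeSpace T := fun x => by
    have : x - f x = g x := by nth_rewrite 1 [← hfg x]; abel
    rw [this]
    exact hg x
  let φ : (Fin n → ℝ) →ₗ[ℝ] (Fin n → ℝ) :=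
    { toFun := f
      map_add' := fun x y => (huniq _ _ (add_mem (hf x) (hf y)) (by
        rw [add_sub_add_comm]
        exact add_mem (hsub x) (hsub y))).symm
      map_smul' := fun c x => (huniq _ _ (Submodule.smul_mem _ c (hf x)) (by
        rw [← smul_sub]
        exact Submodule.smul_mem _ c (hsub x))).symm }
  refine ⟨LinearMap.toMatrix' φ, fun x => ?_⟩
  rw [LinearMap.toMatrix'_mulVec]
  exact ⟨hf x, hsub x⟩

theorem IsProjection.isLimitProjection {T : Set (Matrix (Fin n) (Fin n) ℝ)}
    (hT : Disjoint (nullSpace T) (rangeSpace T)) {P : Matrix (Fin n) (Fin n) ℝ}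
    (hP : IsProjection T P) : IsLimitProjection T P where
  mul_left a ha := Matrix.ext_of_mulVec_single fun i => by
    rw [← Matrix.mulVec_mulVec]
    exact mem_nullSpace.1 (hP _).1 a ha
  mul_right a ha := Matrix.ext_of_mulVec_single fun i => by
    set x : Fin n → ℝ := Pi.single i 1
    have h1 : P *ᵥ (x - a *ᵥ x) ∈ rangeSpace T := by
      have := sub_mem (sub_mulVec_mem_rangeSpace ha x) (hP (x - a *ᵥ x)).2
      rwa [sub_sub_cancel] at this
    have h2 := Submodule.disjoint_def.1 hT _ (hP _).1 h1
    rw [Matrix.mulVec_sub, sub_eq_zero, Matrix.mulVec_mulVec] at h2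
    exact h2.symm
  eq_of_fixed L hL := Matrix.ext_of_mulVec_single fun i => by
    have h := mulVec_eq_zero_of_mem_rangeSpace hL (hP (Pi.single i 1)).2
    rw [Matrix.mulVec_sub, sub_eq_zero, Matrix.mulVec_mulVec] at h
    exact h.symm

theorem IsCP.rightConvergent {Sg : Set (Matrix (Fin n) (Fin n) ℝ)} (h : IsCP Sg) :
    RightConvergent Sg := h.rcp

theorem IsCP.exists_isLimitProjection {Sg : Set (Matrix (Fin n) (Fin n) ℝ)} (h : IsCP Sg)
    (C : Set (Matrix (Fin n) (Fin n) ℝ)) (hC : C ⊆ Sg) : ∃ P, IsLimitProjection C P := by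
  obtain ⟨P, hP⟩ := exists_isProjection (h.transversal C hC)
  exact ⟨P, hP.isLimitProjection (h.transversal C hC).disjoint⟩

/-! ### The recursive product: limit description and existence -/

variable {R : Type*} [LinearOrder R]

theorem exists_intervals_of_completeCount_eq_top {A : R → Matrix (Fin n) (Fin n) ℝ} {S : Set R}
    (hI : completeCount A S = ⊤) (m : ℕ) :
    ∃ F : Finset (Set R), F.card = m ∧ (∀ T ∈ F, IsCompleteInterval A S T) ∧
      (F : Set (Set R)).PairwiseDisjoint id := by
  have h : ((m : ℕ) : ℕ∞) < completeCount A S := hI ▸ ENat.natCast_lt_top m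
  simp only [completeCount, lt_iSup_iff] at h
  obtain ⟨F, hF, hdisj, hlt⟩ := h
  obtain ⟨F', hF', hcard⟩ := Finset.exists_subset_card_eq (Nat.cast_lt.1 hlt).le
  exact ⟨F', hcard, fun T hT => hF T (hF' hT), hdisj.subset (Finset.coe_subset.2 hF')⟩

theorem completeCount_eq_top {A : R → Matrix (Fin n) (Fin n) ℝ} {S : Set R}
    (h : ∀ m, ∃ F : Finset (Set R), F.card = m ∧ (∀ T ∈ F, IsCompleteInterval A S T) ∧
      (F : Set (Set R)).PairwiseDisjoint id) : completeCount A S = ⊤ := by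
  refine ENat.eq_top_iff_forall_ge.2 fun m => ?_
  obtain ⟨F, rfl, hF, hdisj⟩ := h m
  exact le_iSup_of_le F (le_iSup_of_le hF (le_iSup_of_le hdisj le_rfl))

theorem IsProduct.tendsto {Sg : Set (Matrix (Fin n) (Fin n) ℝ)} (hfin : Sg.Finite)
    (hCP : IsCP Sg) {A : R → Matrix (Fin n) (Fin n) ℝ} (hA : ∀ r, A r ∈ Sg) {S : Set R}
    {P : Matrix (Fin n) (Fin n) ℝ} (h : IsProduct A S P) :
    Tendsto (finiteProd A S) atTop (𝓝 P) := by
  induction h with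
  | finite S hS => exact tendsto_finiteProd_of_finite A hS
  | projection S P hI hP =>
    have hsub : A '' S ⊆ Sg := Set.image_subset_iff.2 fun r _ => hA r
    refine tendsto_finiteProd_of_intervals (hfin.subset hsub) (hCP.rightConvergent.mono hsub)
      (hP.isLimitProjection (hCP.transversal _ hsub).disjoint) fun m => ?_
    obtain ⟨F, hcard, hF, hdisj⟩ := exists_intervals_of_completeCount_eq_top hI m
    exact ⟨F, hcard, fun T hT => (hF T hT).subset, fun T hT => (hF T hT).no_holes,
      fun T hT => (hF T hT).image_eq.ge, hdisj⟩
  | concat S k T P hI hunion hlt hinc hprod ih =>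
    rw [← hunion]
    exact tendsto_finiteProd_iUnion hlt ih

theorem isCuttable_of_completeCount_ne_top {A : R → Matrix (Fin n) (Fin n) ℝ} {S : Set R}
    (hfin : (A '' S).Finite) (hS : S.Infinite) (hI : completeCount A S ≠ ⊤) :
    IsCuttable A (A '' S) S := by
  classical
  by_contra hcut
  refine hI (completeCount_eq_top fun m => ?_)
  -- With a single value, every point is a complete interval; with several values, singletons are
  -- incomplete, as the splitting argument needs.
  by_cases hone : ∃ x, A '' S ⊆ {A x}
  · obtain ⟨x, hx⟩ := hone
    obtain ⟨t, htS, hcard⟩ := hS.exists_subset_card_eq m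
    refine ⟨t.image fun y => {y}, ?_, ?_, ?_⟩
    · rw [Finset.card_image_of_injective _ Set.singleton_injective, hcard]
    · simp only [Finset.forall_mem_image]
      intro y hy
      refine ⟨by simpa using htS hy, ?_, ?_⟩
      · rintro _ rfl _ rfl g - h1 h2
        exact absurd h1 h2.not_gt
      · have h1 : A y = A x := hx ⟨y, htS hy, rfl⟩
        refine (Set.image_mono (by simpa using htS hy)).antisymm ?_
        rw [Set.image_singleton, h1]
        exact hx
    · intro X hX Y hY hXY
      simp only [Finset.coe_image, Set.mem_image] at hX hY
      obtain ⟨a, -, rfl⟩ := hX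
      obtain ⟨b, -, rfl⟩ := hY
      exact Set.disjoint_singleton.2 fun h => hXY (h ▸ rfl)
  · push Not at hone
    obtain ⟨F, hcard, hsub, hconv, himg, hdisj⟩ := exists_intervals_of_not_isCuttable hfin
      (hS.nonempty.image A) hone hcut m
    exact ⟨F, hcard, fun T hT => ⟨hsub T hT, hconv T hT,
      (Set.image_mono (hsub T hT)).antisymm (himg T hT)⟩, hdisj⟩

theorem exists_isProduct {Sg : Set (Matrix (Fin n) (Fin n) ℝ)} (hfin : Sg.Finite)
    (hCP : IsCP Sg) {A : R → Matrix (Fin n) (Fin n) ℝ} (hA : ∀ r, A r ∈ Sg) (S : Set R) :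
    ∃ P, IsProduct A S P := by
  induction hk : (A '' S).ncard using Nat.strong_induction_on generalizing S with
  | _ k ih =>
  have hsub : A '' S ⊆ Sg := Set.image_subset_iff.2 fun r _ => hA r
  rcases S.finite_or_infinite with hS | hS
  · exact ⟨_, .finite S hS⟩
  by_cases hI : completeCount A S = ⊤
  · obtain ⟨P, hP⟩ := exists_isProjection (hCP.transversal _ hsub)
    exact ⟨P, .projection S P hI hP⟩
  obtain ⟨l, hlt, hinc, hmem⟩ := isCuttable_of_completeCount_ne_top (hfin.subset hsub) hS hI
  have hex : ∀ i : Fin l.length, ∃ P, IsProduct A (l.get i) P := by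
    intro i
    have hi : l.get i ∈ l := List.get_mem l i
    -- An incomplete part takes strictly fewer values, which drives the recursion.
    refine ih _ ?_ (l.get i) rfl
    rw [← hk]
    exact Set.ncard_lt_ncard ⟨Set.image_mono fun x hx => (hmem x).2 ⟨_, hi, hx⟩, hinc _ hi⟩
      (hfin.subset hsub)
  choose P hP using hex
  refine ⟨_, .concat S l.length l.get P hI ?_ ?_ ?_ hP⟩
  · ext x
    rw [hmem, Set.mem_iUnion]
    exact ⟨fun ⟨i, hi⟩ => ⟨_, List.get_mem l i, hi⟩, fun ⟨X, hX, hx⟩ => by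
      obtain ⟨i, rfl⟩ := List.get_of_mem hX
      exact ⟨i, hx⟩⟩
  · exact fun i j hij => List.pairwise_iff_get.1 hlt i j hij
  · exact fun i h => hinc _ (List.get_mem l i) h.ge

end Matrices

end ContProd

theorem theorem5p3 {n : ℕ} (Sg : Set (Matrix (Fin n) (Fin n) ℝ)) (hfin : Sg.Finite)
    (hCP : ContProd.IsCP Sg) :
    ∃ V : ℝ≥0, ∀ (R : Type u) [LinearOrder R] (A : R → Matrix (Fin n) (Fin n) ℝ),
      (∀ r, A r ∈ Sg) →
        (∀ S : Set R, ∃! P : Matrix (Fin n) (Fin n) ℝ, ContProd.IsProduct A S P) ∧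
        ∀ (Q : Type v) [LinearOrder Q] (B : Q → Set R), Monotone B →
          eVariationOn (fun q => ContProd.M A (B q)) Set.univ ≤ (V : ℝ≥0∞) := by
  let _ := Matrix.linftyOpNormedRing (n := Fin n) (α := ℝ)
  let _ := Matrix.linftyOpNormedAlgebra (n := Fin n) (R := ℝ) (α := ℝ)
  obtain ⟨V, hV⟩ := ContProd.exists_finiteProd_variation_le hfin hCP.rightConvergent
    hCP.exists_isLimitProjection
  refine ⟨V.toNNReal, fun R _ A hA => ?_⟩
  have hex := ContProd.exists_isProduct hfin hCP hA
  have hM : ∀ S, Tendsto (ContProd.finiteProd A S) atTop (𝓝 (ContProd.M A S)) := fun S =>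
    (Classical.epsilon_spec (hex S)).tendsto hfin hCP hA
  refine ⟨fun S => ?_, fun Q _ B hB => ?_⟩
  · obtain ⟨P, hP⟩ := hex S
    exact ⟨P, hP, fun P' hP' =>
      tendsto_nhds_unique (hP'.tendsto hfin hCP hA) (hP.tendsto hfin hCP hA)⟩
  · refine iSup_le fun p => ?_
    obtain ⟨N, q, hq, -⟩ := p
    have hsum : ∑ i ∈ Finset.range N,
        dist (ContProd.M A (B (q (i + 1)))) (ContProd.M A (B (q i))) ≤ V := by
      refine le_of_tendsto' (tendsto_finsetSum _ fun i _ =>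
        (hM (B (q (i + 1)))).dist (hM (B (q i)))) fun F => ?_
      simpa only [dist_eq_norm] using hV R A hA (fun i => B (q i)) (hB.comp hq) F N
    simp only [edist_dist]
    rw [← ENNReal.ofReal_sum_of_nonneg fun _ _ => dist_nonneg]
    exact ENNReal.ofReal_le_ofReal hsum
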